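/- Let $G$ be a finite connected simple graph that is vertex-transitive, i.e. whose automorphism group acts transitively on $V(G)$. Then $G$ is essentially 4-connected, or a cycle, or a complete graph on at most four vertices. Here the following definitions are used. A graph is *3-connected* if it has more than three vertices and remains connected whenever fewer than three vertices are deleted. A *mixed-separation* of $G$ is a pair $(A,B)$ of vertex sets with $A\cup B=V(G)$ such that $A\setminus B$ and $B\setminus A$ are nonempty; its *separator* is the disjoint union of the vertex set $A\cap B$ and the set of edges between $A\setminus B$ and $B\setminus A$. A *tri-separation* is a mixed-separation $(A,B)$ whose separator has exactly three elements and such that every vertex in $A\cap B$ has at least two neighbours in $A$ and at least two neighbours in $B$. It is *strong* if every vertex in $A\cap B$ has degree at least four in $G$, and *nontrivial* if both induced subgraphs $G[A]$ and $G[B]$ contain a cycle. The graph $G$ is *essentially 4-connected* if it is 3-connected, it is not $K_4$, and for every nontrivial strong tri-separation $(A,B)$ of $G$ the separator consists of three edges and $G[A]$ or $G[B]$ is a triangle. -/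

import Mathlib

namespace SimpleGraph

variable {V : Type*}

/-- The automorphism group of `G` acts transitively on the vertices. -/
def IsVertexTransitive (G : SimpleGraph V) : Prop :=
  ∀ u v : V, ∃ φ : G ≃g G, φ u = v

/-- `G` has more than three vertices and stays connected when fewer than three vertices are
deleted. -/
def IsThreeConnected (G : SimpleGraph V) : Prop :=
  3 < ENat.card V ∧ ∀ X : Set V, X.encard < 3 → (G.induce Xᶜ).Connected

/-- A mixed-separation `(A, B)`: the sides cover the vertex set and neither contains the other. -/
def IsMixedSeparation (_G : SimpleGraph V) (A B : Set V) : Prop :=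
  A ∪ B = Set.univ ∧ (A \ B).Nonempty ∧ (B \ A).Nonempty

/-- The edges in the separator of `(A, B)`: those joining `A \ B` to `B \ A`. -/
def separatorEdges (G : SimpleGraph V) (A B : Set V) : Set (Sym2 V) :=
  {e | e ∈ G.edgeSet ∧ ∃ a ∈ A \ B, ∃ b ∈ B \ A, e = s(a, b)}

/-- The order of `(A, B)`: the size of the disjoint union of the vertices in `A ∩ B` and the edges
joining `A \ B` to `B \ A`. -/
noncomputable def separationOrder (G : SimpleGraph V) (A B : Set V) : ℕ∞ :=
  (A ∩ B).encard + (G.separatorEdges A B).encard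

/-- A tri-separation: a mixed-separation of order three such that every vertex in `A ∩ B` has at
least two neighbours in `A` and at least two neighbours in `B`. -/
def IsTriSeparation (G : SimpleGraph V) (A B : Set V) : Prop :=
  G.IsMixedSeparation A B ∧ G.separationOrder A B = 3 ∧
    ∀ v ∈ A ∩ B, 2 ≤ (G.neighborSet v ∩ A).encard ∧ 2 ≤ (G.neighborSet v ∩ B).encard

/-- A strong tri-separation: every vertex in its separator has degree at least four. -/
def IsStrongTriSeparation (G : SimpleGraph V) (A B : Set V) : Prop :=
  G.IsTriSeparation A B ∧ ∀ v ∈ A ∩ B, 4 ≤ (G.neighborSet v).encard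

/-- `(A, B)` is nontrivial if both `G[A]` and `G[B]` include a cycle. -/
def IsNontrivialSeparation (G : SimpleGraph V) (A B : Set V) : Prop :=
  ¬ (G.induce A).IsAcyclic ∧ ¬ (G.induce B).IsAcyclic

/-- The subgraph of `G` induced by `A` is a triangle. -/
def InducesTriangle (G : SimpleGraph V) (A : Set V) : Prop :=
  Nonempty (G.induce A ≃g completeGraph (Fin 3))

/-- `G` is 3-connected, every nontrivial strong tri-separation of `G` has three edges in its
separator and a side that induces a triangle, and `G` is not `K₄`. -/
def IsEssentiallyFourConnected (G : SimpleGraph V) : Prop :=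
  G.IsThreeConnected ∧
    (∀ A B : Set V, G.IsStrongTriSeparation A B → G.IsNontrivialSeparation A B →
      (G.separatorEdges A B).encard = 3 ∧ (G.InducesTriangle A ∨ G.InducesTriangle B)) ∧
    ¬ Nonempty (G ≃g completeGraph (Fin 4))

/-- `G` is a cycle (of length at least three). -/
def IsCycleGraph (G : SimpleGraph V) : Prop :=
  ∃ n : ℕ, 3 ≤ n ∧ Nonempty (G ≃g cycleGraph n)

end SimpleGraph

namespace SimpleGraph

variable {V : Type*}

/-- `P`, `S`, `Q` partition the vertices, `P` and `Q` are nonempty and no edge joins them. -/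
structure IsVertexSep (G : SimpleGraph V) (P S Q : Finset V) : Prop where
  cover : ∀ v, v ∈ P ∨ v ∈ S ∨ v ∈ Q
  disj_left : ∀ v ∈ P, v ∉ S
  disj_right : ∀ v ∈ Q, v ∉ S
  disj_sides : ∀ v ∈ P, v ∉ Q
  nonempty_left : P.Nonempty
  nonempty_right : Q.Nonempty
  not_adj : ∀ u ∈ P, ∀ v ∈ Q, ¬ G.Adj u v

namespace IsVertexSep

variable {G : SimpleGraph V} {P S Q P' S' Q' : Finset V}

theorem symm (h : G.IsVertexSep P S Q) : G.IsVertexSep Q S P where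
  cover v := by have := h.cover v; tauto
  disj_left := h.disj_right
  disj_right := h.disj_left
  disj_sides v hv hv' := h.disj_sides v hv' hv
  nonempty_left := h.nonempty_right
  nonempty_right := h.nonempty_left
  not_adj u hu v hv huv := h.not_adj v hv u hu huv.symm

theorem map (h : G.IsVertexSep P S Q) (φ : G ≃g G) :
    G.IsVertexSep (P.map φ.toEquiv.toEmbedding) (S.map φ.toEquiv.toEmbedding)
      (Q.map φ.toEquiv.toEmbedding) where
  cover v := by
    simp only [Finset.mem_map_equiv]
    exact h.cover _
  disj_left v := by
    simp only [Finset.mem_map_equiv]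
    exact h.disj_left _
  disj_right v := by
    simp only [Finset.mem_map_equiv]
    exact h.disj_right _
  disj_sides v := by
    simp only [Finset.mem_map_equiv]
    exact h.disj_sides _
  nonempty_left := h.nonempty_left.map
  nonempty_right := h.nonempty_right.map
  not_adj u hu v hv := by
    simp only [Finset.mem_map_equiv] at hu hv
    intro huv
    exact h.not_adj _ hu _ hv ((φ.symm.map_adj_iff).2 huv)

variable [DecidableEq V]

theorem card_inter_add (h : G.IsVertexSep P S Q) (X : Finset V) :
    X.card = (X ∩ P).card + (X ∩ S).card + (X ∩ Q).card := by
  have h1 : X = (X ∩ P ∪ X ∩ S) ∪ X ∩ Q := by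
    ext v
    have := h.cover v
    simp only [Finset.mem_union, Finset.mem_inter]
    tauto
  have hd : Disjoint (X ∩ P ∪ X ∩ S) (X ∩ Q) := by
    rw [Finset.disjoint_left]
    intro v hv hv'
    have h1 := h.disj_sides v
    have h2 := h.disj_right v
    simp only [Finset.mem_union, Finset.mem_inter] at hv hv'
    tauto
  have hd' : Disjoint (X ∩ P) (X ∩ S) := by
    rw [Finset.disjoint_left]
    intro v hv hv'
    exact h.disj_left v (Finset.mem_inter.1 hv).2 (Finset.mem_inter.1 hv').2
  conv_lhs => rw [h1]
  rw [Finset.card_union_of_disjoint hd, Finset.card_union_of_disjoint hd']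

/-- The corner `P ∩ P'` of two vertex separations. -/
theorem corner (h : G.IsVertexSep P S Q) (h' : G.IsVertexSep P' S' Q') (hne : (P ∩ P').Nonempty) :
    G.IsVertexSep (P ∩ P') (P ∩ S' ∪ S ∩ S' ∪ S ∩ P') (Q ∪ Q') where
  cover v := by
    have h1 := h.cover v
    have h2 := h'.cover v
    simp only [Finset.mem_union, Finset.mem_inter]
    tauto
  disj_left v hv := by
    have h1 := h.disj_left v
    have h2 := h'.disj_left v
    simp only [Finset.mem_union, Finset.mem_inter] at hv ⊢
    tauto
  disj_right v hv := by
    have h1 := h.disj_right v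
    have h2 := h'.disj_right v
    have h3 := h.disj_sides v
    have h4 := h'.disj_sides v
    simp only [Finset.mem_union, Finset.mem_inter] at hv ⊢
    tauto
  disj_sides v hv := by
    have h3 := h.disj_sides v
    have h4 := h'.disj_sides v
    simp only [Finset.mem_union, Finset.mem_inter] at hv ⊢
    tauto
  nonempty_left := hne
  nonempty_right := h.nonempty_right.mono Finset.subset_union_left
  not_adj u hu v hv := by
    simp only [Finset.mem_union, Finset.mem_inter] at hu hv
    rcases hv with hv | hv
    · exact h.not_adj u hu.1 v hv
    · exact h'.not_adj u hu.2 v hv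

theorem card_corner_le (P S P' S' : Finset V) :
    (P ∩ S' ∪ S ∩ S' ∪ S ∩ P').card ≤ (S' ∩ P).card + (S ∩ S').card + (S ∩ P').card := by
  rw [Finset.inter_comm S' P]
  exact (Finset.card_union_le _ _).trans (Nat.add_le_add_right (Finset.card_union_le _ _) _)

/-- If two opposite corners of separations of minimum order `k` are nonempty, then each of them
has order `k`. -/
theorem card_corner_eq {k : ℕ} (hk : ∀ P S Q : Finset V, G.IsVertexSep P S Q → k ≤ S.card)
    (h : G.IsVertexSep P S Q) (h' : G.IsVertexSep P' S' Q') (hS : S.card = k) (hS' : S'.card = k)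
    (hne : (P ∩ P').Nonempty) (hne' : (Q ∩ Q').Nonempty) :
    (P ∩ S' ∪ S ∩ S' ∪ S ∩ P').card = k := by
  have h1 := hk _ _ _ (h.corner h' hne)
  have h2 := hk _ _ _ (h.symm.corner h'.symm hne')
  have h3 := card_corner_le P S P' S'
  have h4 := card_corner_le Q S Q' S'
  have h5 := h.card_inter_add S'
  have h6 := h'.card_inter_add S
  rw [Finset.inter_comm S' S] at h5
  omega

end IsVertexSep

theorem Connected.exists_adj_boundary {G : SimpleGraph V} (hG : G.Connected) {p : V → Prop}
    {u v : V} (hu : p u) (hv : ¬ p v) : ∃ x y, p x ∧ ¬ p y ∧ G.Adj x y := by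
  obtain ⟨w⟩ := hG.preconnected u v
  obtain ⟨d, -, h1, h2⟩ := w.exists_boundary_dart {x | p x} hu hv
  exact ⟨d.fst, d.snd, h1, h2, d.adj⟩

/-- A side of smallest size `a` among the vertex separations of order `k`. -/
def IsAtom (G : SimpleGraph V) (k a : ℕ) (P S Q : Finset V) : Prop :=
  G.IsVertexSep P S Q ∧ S.card = k ∧ P.card = a

section Atoms

variable [DecidableEq V] {G : SimpleGraph V} {k a : ℕ} {P S Q P' S' Q' : Finset V}

theorem IsAtom.eq_of_inter_nonempty
    (hk : ∀ P S Q : Finset V, G.IsVertexSep P S Q → k ≤ S.card)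
    (ha : ∀ P S Q : Finset V, G.IsVertexSep P S Q → S.card = k → a ≤ P.card)
    (h : G.IsAtom k a P S Q) (h' : G.IsAtom k a P' S' Q') (hne : (P ∩ P').Nonempty) : P = P' := by
  obtain ⟨h, hS, hP⟩ := h
  obtain ⟨h', hS', hP'⟩ := h'
  have hne' : (Q ∩ Q').Nonempty := by
    by_contra hemp
    rw [Finset.not_nonempty_iff_eq_empty] at hemp
    have h1 := hk _ _ _ (h.corner h' hne)
    have h2 := IsVertexSep.card_corner_le P S P' S'
    have h3 := h.card_inter_add S'
    have h4 := h'.card_inter_add Q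
    have h5 := h.card_inter_add P'
    have h6 := ha _ _ _ h.symm hS
    have h7 := hne.card_pos
    rw [hemp, Finset.card_empty] at h4
    rw [Finset.inter_comm S' S, Finset.inter_comm S' Q] at h3
    rw [Finset.inter_comm P' P, Finset.inter_comm P' S, Finset.inter_comm P' Q] at h5
    omega
  have h1 := ha _ _ _ (h.corner h' hne) (IsVertexSep.card_corner_eq hk h h' hS hS' hne hne')
  have h2 : P ∩ P' = P := Finset.eq_of_subset_of_card_le Finset.inter_subset_left (by omega)
  have h3 : P ∩ P' = P' := Finset.eq_of_subset_of_card_le Finset.inter_subset_right (by omega)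
  exact h2.symm.trans h3

theorem IsAtom.subset_separator
    (hk : ∀ P S Q : Finset V, G.IsVertexSep P S Q → k ≤ S.card)
    (ha : ∀ P S Q : Finset V, G.IsVertexSep P S Q → S.card = k → a ≤ P.card)
    (h : G.IsAtom k a P S Q) (h' : G.IsAtom k a P' S' Q') (hne : (P' ∩ S).Nonempty) :
    P' ⊆ S := by
  have hdisj : P ∩ P' = ∅ := by
    by_contra hne'
    have := h.eq_of_inter_nonempty hk ha h' (Finset.nonempty_iff_ne_empty.2 hne')
    subst this
    obtain ⟨v, hv⟩ := hne
    rw [Finset.mem_inter] at hv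
    exact h.1.disj_left v hv.1 hv.2
  obtain ⟨h, hS, hP⟩ := h
  obtain ⟨h', hS', hP'⟩ := h'
  by_contra hsub
  have hcross : (P' ∩ Q).Nonempty := by
    obtain ⟨v, hv, hv'⟩ := Finset.not_subset.1 hsub
    refine ⟨v, Finset.mem_inter.2 ⟨hv, ?_⟩⟩
    rcases h.cover v with hc | hc | hc
    · exact absurd (Finset.mem_inter.2 ⟨hc, hv⟩) (by simp [hdisj])
    · exact absurd hc hv'
    · exact hc
  have h5 := h.card_inter_add P'
  have h8 := hne.card_pos
  by_cases hne' : (Q' ∩ P).Nonempty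
  · have h1 := ha _ _ _ (h'.corner h.symm hcross)
      (IsVertexSep.card_corner_eq hk h' h.symm hS' hS hcross hne')
    omega
  · rw [Finset.not_nonempty_iff_eq_empty] at hne'
    have h1 := hk _ _ _ (h'.corner h.symm hcross)
    have h2 := IsVertexSep.card_corner_le P' S' Q S
    have h3 := h.card_inter_add S'
    have h4 := h'.card_inter_add P
    rw [hdisj, Finset.inter_comm P Q', hne', Finset.card_empty] at h4
    rw [Finset.inter_comm S' P] at h3
    rw [Finset.inter_comm S P'] at h2
    have h9 : P' ∩ S = P' := Finset.eq_of_subset_of_card_le Finset.inter_subset_left (by omega)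
    exact hsub (Finset.inter_eq_left.1 h9)

end Atoms

/-- A connected vertex-transitive graph of degree more than `c ≤ 3` has no vertex separation of
order at most `c`. -/
theorem IsVertexSep.lt_card_of_isVertexTransitive [Fintype V] {G : SimpleGraph V}
    [DecidableRel G.Adj] (hconn : G.Connected) (htrans : G.IsVertexTransitive) {c : ℕ} (hc : c ≤ 3)
    (hdeg : ∀ v, c < G.degree v) {P S Q : Finset V} (h : G.IsVertexSep P S Q) : c < S.card := by
  classical
  by_contra! hle
  have hex : ∃ k, ∃ P S Q : Finset V, G.IsVertexSep P S Q ∧ S.card = k := ⟨_, P, S, Q, h, rfl⟩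
  obtain ⟨k, hkdef⟩ : ∃ k, k = Nat.find hex := ⟨_, rfl⟩
  have hk : ∀ P S Q : Finset V, G.IsVertexSep P S Q → k ≤ S.card := fun P S Q h => by
    rw [hkdef]
    exact Nat.find_min' hex ⟨P, S, Q, h, rfl⟩
  have hex' : ∃ a, ∃ P S Q : Finset V, G.IsAtom k a P S Q := by
    obtain ⟨P, S, Q, h, hS⟩ := Nat.find_spec hex
    exact ⟨_, P, S, Q, h, hS.trans hkdef.symm, rfl⟩
  obtain ⟨a, hadef⟩ : ∃ a, a = Nat.find hex' := ⟨_, rfl⟩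
  have ha : ∀ P S Q : Finset V, G.IsVertexSep P S Q → S.card = k → a ≤ P.card :=
    fun P S Q h hS => by
      rw [hadef]
      exact Nat.find_min' hex' ⟨P, S, Q, h, hS, rfl⟩
  have hkc : k ≤ c := (hk _ _ _ h).trans hle
  clear h hle P S Q
  obtain ⟨P, S, Q, hP⟩ : ∃ P S Q : Finset V, G.IsAtom k a P S Q := by
    rw [hadef]
    exact Nat.find_spec hex'
  have hatom : ∀ v, ∃ P S Q : Finset V, G.IsAtom k a P S Q ∧ v ∈ P := by
    intro v
    obtain ⟨u, hu⟩ := hP.1.nonempty_left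
    obtain ⟨φ, hφ⟩ := htrans u v
    refine ⟨_, _, _, ⟨hP.1.map φ, by simpa using hP.2.1, by simpa using hP.2.2⟩, ?_⟩
    exact Finset.mem_map.2 ⟨u, hu, hφ⟩
  have ha2 : 2 ≤ a := by
    by_contra! hlt
    obtain ⟨v, hv⟩ := hP.1.nonempty_left
    have hPv : ∀ u ∈ P, u = v := fun u hu =>
      Finset.card_le_one.1 (by rw [hP.2.2]; omega) u hu v hv
    have hsub : G.neighborFinset v ⊆ S := by
      intro w hw
      rw [mem_neighborFinset] at hw
      rcases hP.1.cover w with h1 | h1 | h1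
      · exact absurd (hPv w h1) hw.ne'
      · exact h1
      · exact absurd hw (hP.1.not_adj v hv w h1)
    have h1 := Finset.card_le_card hsub
    rw [card_neighborFinset_eq_degree, hP.2.1] at h1
    exact absurd (hdeg v) (by omega)
  obtain ⟨p, hp⟩ := hP.1.nonempty_left
  obtain ⟨q, hq⟩ := hP.1.nonempty_right
  obtain ⟨x, y, hx, hy, hxy⟩ := hconn.exists_adj_boundary (p := (· ∈ P)) hp
    (fun hqP => hP.1.disj_sides q hqP hq)
  have hyS : y ∈ S := by
    rcases hP.1.cover y with h1 | h1 | h1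
    · exact absurd h1 hy
    · exact h1
    · exact absurd hxy (hP.1.not_adj x hx y h1)
  obtain ⟨P', S', Q', hP', hyP'⟩ := hatom y
  have hsub := hP.subset_separator hk ha hP' ⟨y, Finset.mem_inter.2 ⟨hyP', hyS⟩⟩
  have hSP' : P' = S := by
    by_contra hne
    obtain ⟨z, hzS, hzP'⟩ := Finset.exists_of_ssubset (hsub.ssubset_of_ne hne)
    obtain ⟨R, T, U, hR, hzR⟩ := hatom z
    have hsub' := hP.subset_separator hk ha hR ⟨z, Finset.mem_inter.2 ⟨hzR, hzS⟩⟩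
    have hdis : Disjoint P' R := by
      rw [Finset.disjoint_iff_inter_eq_empty]
      by_contra hne'
      have := hP'.eq_of_inter_nonempty hk ha hR (Finset.nonempty_iff_ne_empty.2 hne')
      exact hzP' (this ▸ hzR)
    have h1 := Finset.card_le_card (Finset.union_subset hsub hsub')
    rw [Finset.card_union_of_disjoint hdis, hP'.2.2, hR.2.2, hP.2.1] at h1
    omega
  subst hSP'
  have hxS' : x ∈ S' := by
    rcases hP'.1.cover x with h1 | h1 | h1
    · exact absurd h1 (hP.1.disj_left x hx)
    · exact h1
    · exact absurd hxy.symm (hP'.1.not_adj y hyP' x h1)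
  have hsub' := hP'.subset_separator hk ha hP ⟨x, Finset.mem_inter.2 ⟨hx, hxS'⟩⟩
  have hPS' : P = S' := Finset.eq_of_subset_of_card_le hsub' (by
    rw [hP.2.2, hP'.2.1, ← hP.2.1, hP'.2.2])
  subst hPS'
  obtain ⟨u, v, hu, hv, huv⟩ := hconn.exists_adj_boundary (p := (· ∈ Q)) hq
    (fun hpQ => hP.1.disj_sides p hp hpQ)
  rcases hP.1.cover v with h1 | h1 | h1
  · exact hP.1.not_adj v h1 u hu huv.symm
  · rcases hP'.1.cover u with h2 | h2 | h2
    · exact hP.1.disj_right u hu h2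
    · exact hP.1.disj_sides u h2 hu
    · exact hP'.1.not_adj v h1 u h2 huv.symm
  · exact hv h1

/-- The number of pairs of adjacent vertices in `X × Y`. -/
def edgeCount (G : SimpleGraph V) [DecidableRel G.Adj] (X Y : Finset V) : ℕ :=
  ∑ x ∈ X, (Y.filter (G.Adj x)).card

section EdgeCount

variable (G : SimpleGraph V) [DecidableRel G.Adj]

theorem edgeCount_eq_sum (X Y : Finset V) :
    G.edgeCount X Y = ∑ x ∈ X, ∑ y ∈ Y, if G.Adj x y then 1 else 0 := by
  simp only [edgeCount, Finset.card_filter]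

theorem edgeCount_comm (X Y : Finset V) : G.edgeCount X Y = G.edgeCount Y X := by
  rw [edgeCount_eq_sum, edgeCount_eq_sum, Finset.sum_comm]
  simp only [G.adj_comm]

theorem edgeCount_union_left [DecidableEq V] {X X' : Finset V} (h : Disjoint X X')
    (Y : Finset V) : G.edgeCount (X ∪ X') Y = G.edgeCount X Y + G.edgeCount X' Y :=
  Finset.sum_union h

theorem edgeCount_union_right [DecidableEq V] (X : Finset V) {Y Y' : Finset V}
    (h : Disjoint Y Y') : G.edgeCount X (Y ∪ Y') = G.edgeCount X Y + G.edgeCount X Y' := by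
  rw [edgeCount_comm, edgeCount_union_left G h, edgeCount_comm G Y, edgeCount_comm G Y']

end EdgeCount

/-- If every vertex separation has order more than `c` and every degree is more than `c`, then
every mixed separation has order more than `c`. -/
theorem lt_card_add_edgeCount [Fintype V] [DecidableEq V] {G : SimpleGraph V} [DecidableRel G.Adj]
    {c : ℕ} (hsep : ∀ P S Q : Finset V, G.IsVertexSep P S Q → c < S.card)
    (hdeg : ∀ v, c < G.degree v) {X K Y : Finset V} (hcover : ∀ v, v ∈ X ∨ v ∈ K ∨ v ∈ Y)
    (hXK : Disjoint X K) (hKY : Disjoint K Y) (hXY : Disjoint X Y)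
    (hX : X.Nonempty) (hY : Y.Nonempty) : c < K.card + G.edgeCount X Y := by
  by_contra! hle
  have hfilter : (X.filter fun x => ∃ y ∈ Y, G.Adj x y).card ≤ G.edgeCount X Y := by
    rw [Finset.card_filter]
    refine Finset.sum_le_sum fun x _ => ?_
    split_ifs with hx
    · obtain ⟨y, hy, hxy⟩ := hx
      exact Finset.card_pos.2 ⟨y, Finset.mem_filter.2 ⟨hy, hxy⟩⟩
    · exact Nat.zero_le _
  have hall : ∀ x ∈ X, ∃ y ∈ Y, G.Adj x y := by
    by_contra! hex
    obtain ⟨x, hx, hxy⟩ := hex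
    have h1 : G.IsVertexSep (X.filter fun x => ¬ ∃ y ∈ Y, G.Adj x y)
        (K ∪ X.filter fun x => ∃ y ∈ Y, G.Adj x y) Y := by
      rw [Finset.disjoint_left] at hXK hKY hXY
      refine ⟨fun v => ?_, fun v hv => ?_, fun v hv => ?_, fun v hv => ?_,
        ⟨x, Finset.mem_filter.2 ⟨hx, ?_⟩⟩, hY, fun u hu v hv huv => ?_⟩
      · have := hcover v
        simp only [Finset.mem_union, Finset.mem_filter]
        by_cases hv : ∃ y ∈ Y, G.Adj v y <;> simp only [hv, not_true, not_false_iff] <;> tauto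
      · rw [Finset.mem_filter] at hv
        rw [Finset.mem_union, not_or]
        exact ⟨hXK hv.1, fun hv' => hv.2 (Finset.mem_filter.1 hv').2⟩
      · have h1 := @hKY v
        have h2 := @hXY v
        simp only [Finset.mem_union, Finset.mem_filter]
        tauto
      · exact hXY (Finset.mem_filter.1 hv).1
      · push Not
        exact hxy
      · exact (Finset.mem_filter.1 hu).2 ⟨v, hv, huv⟩
    have h2 := hsep _ _ _ h1
    have h3 := Finset.card_union_le K (X.filter fun x => ∃ y ∈ Y, G.Adj x y)
    omega
  rw [Finset.filter_true_of_mem hall] at hfilter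
  have hcount : ∀ x ∈ X, c + 2 ≤ X.card + K.card + (Y.filter (G.Adj x)).card := by
    intro x hx
    have h1 : G.neighborFinset x ⊆ (X.erase x ∪ K) ∪ Y.filter (G.Adj x) := by
      intro v hv
      rw [mem_neighborFinset] at hv
      have := hcover v
      have := hv.ne'
      simp only [Finset.mem_union, Finset.mem_erase, Finset.mem_filter]
      tauto
    have h2 := Finset.card_le_card h1
    have h3 := Finset.card_union_le (X.erase x ∪ K) (Y.filter (G.Adj x))
    have h4 := Finset.card_union_le (X.erase x) K
    have h5 := Finset.card_erase_add_one hx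
    have h6 := hdeg x
    rw [card_neighborFinset_eq_degree] at h2
    omega
  have hsum : X.card * (c + 2) ≤ X.card * (X.card + K.card) + G.edgeCount X Y := by
    have h1 := Finset.sum_le_sum hcount
    rwa [Finset.sum_const, Finset.sum_add_distrib, Finset.sum_const, smul_eq_mul, smul_eq_mul]
      at h1
  have hpos := hX.card_pos
  obtain ⟨j, hj⟩ : ∃ j, c = K.card + j := ⟨c - K.card, by omega⟩
  have hej : G.edgeCount X Y ≤ j := by omega
  obtain ⟨i, hi⟩ : ∃ i, j = X.card + i := ⟨j - X.card, by omega⟩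
  obtain ⟨m, hm⟩ : ∃ m, X.card = m + 1 := ⟨X.card - 1, by omega⟩
  rw [hm] at hi hsum
  rw [hj, hi] at hsum
  rw [hi] at hej
  nlinarith [Nat.zero_le (m * i)]

/-- In a graph without edge cuts of size less than three, two edge cuts of size three do not
cross. -/
theorem not_crossing_of_edgeCount_eq_three [Fintype V] [DecidableEq V] {G : SimpleGraph V}
    [DecidableRel G.Adj]
    (hcut : ∀ X : Finset V, X.Nonempty → Xᶜ.Nonempty → 2 < G.edgeCount X Xᶜ) {X Y : Finset V}
    (hX : G.edgeCount X Xᶜ = 3) (hY : G.edgeCount Y Yᶜ = 3) (h1 : (X ∩ Y).Nonempty)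
    (h2 : (X ∩ Yᶜ).Nonempty) (h3 : (Xᶜ ∩ Y).Nonempty) (h4 : (Xᶜ ∩ Yᶜ).Nonempty) : False := by
  have e1 : X = X ∩ Y ∪ X ∩ Yᶜ := by ext; simp; tauto
  have e2 : Xᶜ = Xᶜ ∩ Y ∪ Xᶜ ∩ Yᶜ := by ext; simp; tauto
  have e3 : Y = X ∩ Y ∪ Xᶜ ∩ Y := by ext; simp; tauto
  have e4 : Yᶜ = X ∩ Yᶜ ∪ Xᶜ ∩ Yᶜ := by ext; simp; tauto
  generalize hp : X ∩ Y = p at *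
  generalize hq : X ∩ Yᶜ = q at *
  generalize hr : Xᶜ ∩ Y = r at *
  generalize hs : Xᶜ ∩ Yᶜ = s at *
  have dpq : Disjoint p q := by
    subst hp hq; rw [Finset.disjoint_left]; intro v; simp; tauto
  have dpr : Disjoint p r := by
    subst hp hr; rw [Finset.disjoint_left]; intro v; simp; tauto
  have dps : Disjoint p s := by
    subst hp hs; rw [Finset.disjoint_left]; intro v; simp; tauto
  have dqr : Disjoint q r := by
    subst hq hr; rw [Finset.disjoint_left]; intro v; simp; tauto
  have dqs : Disjoint q s := by
    subst hq hs; rw [Finset.disjoint_left]; intro v; simp; tauto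
  have drs : Disjoint r s := by
    subst hr hs; rw [Finset.disjoint_left]; intro v; simp; tauto
  have cp : pᶜ = q ∪ (r ∪ s) := by
    subst hp hq hr hs; ext v; simp; tauto
  have cq : qᶜ = p ∪ (r ∪ s) := by
    subst hp hq hr hs; ext v; simp; tauto
  have cr : rᶜ = p ∪ (q ∪ s) := by
    subst hp hq hr hs; ext v; simp; tauto
  have cs : sᶜ = p ∪ (q ∪ r) := by
    subst hp hq hr hs; ext v; simp; tauto
  have np := hcut p h1 (by rw [cp]; exact h2.mono Finset.subset_union_left)
  have nq := hcut q h2 (by rw [cq]; exact h1.mono Finset.subset_union_left)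
  have nr := hcut r h3 (by rw [cr]; exact h1.mono Finset.subset_union_left)
  have ns := hcut s h4 (by rw [cs]; exact h1.mono Finset.subset_union_left)
  rw [cp, G.edgeCount_union_right _ (by simp [*]), G.edgeCount_union_right _ drs] at np
  rw [cq, G.edgeCount_union_right _ (by simp [*]), G.edgeCount_union_right _ drs] at nq
  rw [cr, G.edgeCount_union_right _ (by simp [*]), G.edgeCount_union_right _ dqs] at nr
  rw [cs, G.edgeCount_union_right _ (by simp [*]), G.edgeCount_union_right _ dqr] at ns
  rw [e2, e1, G.edgeCount_union_right _ drs, G.edgeCount_union_left dpq,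
    G.edgeCount_union_left dpq] at hX
  rw [e4, e3, G.edgeCount_union_right _ dqs, G.edgeCount_union_left dpr,
    G.edgeCount_union_left dpr] at hY
  have := G.edgeCount_comm p q
  have := G.edgeCount_comm p r
  have := G.edgeCount_comm p s
  have := G.edgeCount_comm q r
  have := G.edgeCount_comm q s
  have := G.edgeCount_comm r s
  omega

/-- In a vertex-transitive graph without edge cuts of size less than three, the smaller side of an
edge cut of size three has at most three vertices. -/
theorem card_le_three_of_edgeCount_eq_three [Fintype V] [DecidableEq V] {G : SimpleGraph V}
    [DecidableRel G.Adj] (htrans : G.IsVertexTransitive)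
    (hcut : ∀ X : Finset V, X.Nonempty → Xᶜ.Nonempty → 2 < G.edgeCount X Xᶜ) {X : Finset V}
    (hX : G.edgeCount X Xᶜ = 3) (hle : X.card ≤ Xᶜ.card) : X.card ≤ 3 := by
  have hinv : ∀ x ∈ X, ∀ φ : G ≃g G, φ x ∈ X → X.map φ.toEquiv.toEmbedding = X := by
    intro x hx φ hφ
    set Y := X.map φ.toEquiv.toEmbedding with hYdef
    have hcard : Y.card = X.card := Finset.card_map _
    have hcompl : Yᶜ = Xᶜ.map φ.toEquiv.toEmbedding := by
      ext v
      simp [hYdef, Finset.mem_map_equiv]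
    have hY : G.edgeCount Y Yᶜ = 3 := by
      rw [← hX, hcompl, edgeCount_eq_sum, edgeCount_eq_sum, Finset.sum_map]
      refine Finset.sum_congr rfl fun u _ => ?_
      rw [Finset.sum_map]
      refine Finset.sum_congr rfl fun v _ => ?_
      exact if_congr φ.map_adj_iff rfl rfl
    have h1 : (X ∩ Y).Nonempty :=
      ⟨φ x, Finset.mem_inter.2 ⟨hφ, Finset.mem_map.2 ⟨x, hx, rfl⟩⟩⟩
    have h4 : (Xᶜ ∩ Yᶜ).Nonempty := by
      rw [← Finset.compl_union, ← Finset.card_pos, Finset.card_compl]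
      have a1 := Finset.card_union_add_card_inter X Y
      have a2 := h1.card_pos
      rw [Finset.card_compl] at hle
      have a3 := Finset.card_le_univ X
      omega
    by_cases h2 : (X ∩ Yᶜ).Nonempty
    · by_cases h3 : (Xᶜ ∩ Y).Nonempty
      · exact (not_crossing_of_edgeCount_eq_three hcut hX hY h1 h2 h3 h4).elim
      · refine Finset.eq_of_subset_of_card_le (fun v hv => ?_) hcard.ge
        by_contra hv'
        exact h3 ⟨v, by simp [hv, hv']⟩
    · refine (Finset.eq_of_subset_of_card_le (fun v hv => ?_) hcard.le).symm
      by_contra hv'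
      exact h2 ⟨v, by simp [hv, hv']⟩
  have hconst : ∀ x ∈ X, ∀ y ∈ X,
      (Xᶜ.filter (G.Adj x)).card = (Xᶜ.filter (G.Adj y)).card := by
    intro x hx y hy
    obtain ⟨φ, rfl⟩ := htrans x y
    have h := hinv x hx φ hy
    rw [← Finset.card_map φ.toEquiv.toEmbedding]
    congr 1
    ext v
    have h1 : v ∈ X ↔ φ.symm v ∈ X := by
      conv_lhs => rw [← h, Finset.mem_map_equiv]
      rfl
    have h2 : G.Adj (φ x) v ↔ G.Adj x (φ.symm v) := by
      rw [← φ.map_adj_iff (v := x), φ.apply_symm_apply]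
    rw [Finset.mem_map_equiv, Finset.mem_filter, Finset.mem_filter, Finset.mem_compl,
      Finset.mem_compl, h1, h2]
    rfl
  by_contra! hlt
  obtain ⟨x, hx⟩ : X.Nonempty := Finset.card_pos.1 (by omega)
  have hsum : G.edgeCount X Xᶜ = X.card * (Xᶜ.filter (G.Adj x)).card :=
    Finset.sum_const_nat fun y hy => hconst y hy x hx
  rw [hX] at hsum
  rcases Nat.eq_zero_or_pos (Xᶜ.filter (G.Adj x)).card with h0 | h0
  · simp [h0] at hsum
  · nlinarith

theorem isThreeConnected_of_forall_isVertexSep [Fintype V] {G : SimpleGraph V}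
    (hcard : 3 < Fintype.card V)
    (hsep : ∀ P S Q : Finset V, G.IsVertexSep P S Q → 2 < S.card) : G.IsThreeConnected := by
  classical
  refine ⟨by rw [ENat.card_eq_coe_fintype_card]; exact_mod_cast hcard, fun X hX => ?_⟩
  have hX' : X.toFinset.card < 3 := by
    rw [Set.encard_eq_coe_toFinset_card] at hX
    exact_mod_cast hX
  rw [connected_iff]
  refine ⟨fun u v => ?_, ?_⟩
  · by_contra huv
    let P : Finset V := {w | ∃ h : w ∈ Xᶜ, (G.induce Xᶜ).Reachable u ⟨w, h⟩}
    let Q : Finset V := {w | ∃ h : w ∈ Xᶜ, ¬ (G.induce Xᶜ).Reachable u ⟨w, h⟩}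
    have hPQ : G.IsVertexSep P X.toFinset Q := by
      refine ⟨fun w => ?_, fun w hw => ?_, fun w hw => ?_, fun w hw => ?_,
        ⟨u, Finset.mem_filter.2 ⟨Finset.mem_univ _, u.2, Reachable.refl _⟩⟩,
        ⟨v, Finset.mem_filter.2 ⟨Finset.mem_univ _, v.2, huv⟩⟩,
        fun w hw x hx hwx => ?_⟩
      · by_cases hw : w ∈ X
        · simp [hw]
        · simp only [P, Q, Finset.mem_filter, Finset.mem_univ, true_and, Set.mem_toFinset]
          by_cases hr : (G.induce Xᶜ).Reachable u ⟨w, hw⟩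
          · exact Or.inl ⟨hw, hr⟩
          · exact Or.inr (Or.inr ⟨hw, hr⟩)
      · obtain ⟨h, -⟩ := (Finset.mem_filter.1 hw).2
        simpa using h
      · obtain ⟨h, -⟩ := (Finset.mem_filter.1 hw).2
        simpa using h
      · obtain ⟨h, hr⟩ := (Finset.mem_filter.1 hw).2
        intro hw'
        obtain ⟨h', hr'⟩ := (Finset.mem_filter.1 hw').2
        exact hr' hr
      · obtain ⟨h, hr⟩ := (Finset.mem_filter.1 hw).2
        obtain ⟨h', hr'⟩ := (Finset.mem_filter.1 hx).2
        exact hr' (hr.trans (Adj.reachable (G := G.induce Xᶜ) (u := ⟨w, h⟩) (v := ⟨x, h'⟩) hwx))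
    have := hsep _ _ _ hPQ
    omega
  · by_contra hemp
    have h1 : X.toFinset = Finset.univ := by
      ext w
      by_contra hw
      exact hemp ⟨w, by simpa using hw⟩
    rw [h1, Finset.card_univ] at hX'
    omega

theorem encard_separatorEdges [Fintype V] [DecidableEq V] (G : SimpleGraph V) [DecidableRel G.Adj]
    (A B : Finset V) :
    (G.separatorEdges (A : Set V) B).encard = G.edgeCount (A \ B) (B \ A) := by
  let E := ((A \ B) ×ˢ (B \ A)).filter fun p => G.Adj p.1 p.2
  have hcard : E.card = G.edgeCount (A \ B) (B \ A) := by
    rw [Finset.card_filter, Finset.sum_product, edgeCount_eq_sum]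
  have himage : G.separatorEdges (A : Set V) B =
      Set.image (fun p : V × V => s(p.1, p.2)) (E : Set (V × V)) := by
    ext e
    constructor
    · rintro ⟨he, a, ha, b, hb, rfl⟩
      refine ⟨(a, b), ?_, rfl⟩
      simp only [E, Finset.coe_filter, Finset.mem_product, Finset.mem_sdiff, Set.mem_ofPred_eq]
      exact ⟨⟨ha, hb⟩, he⟩
    · rintro ⟨⟨a, b⟩, hab, rfl⟩
      simp only [E, Finset.coe_filter, Finset.mem_product, Finset.mem_sdiff, Set.mem_ofPred_eq] at hab
      exact ⟨hab.2, a, hab.1.1, b, hab.1.2, rfl⟩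
  have hinj : Set.InjOn (fun p : V × V => s(p.1, p.2)) (E : Set (V × V)) := by
    rintro ⟨a, b⟩ hab ⟨a', b'⟩ hab' heq
    simp only [E, Finset.coe_filter, Finset.mem_product, Finset.mem_sdiff, Set.mem_ofPred_eq]
      at hab hab'
    rcases Sym2.eq_iff.1 heq with ⟨h1, h2⟩ | ⟨h1, h2⟩
    · exact Prod.ext h1 h2
    · dsimp only at h1
      exact absurd (h1 ▸ hab.1.1.1) hab'.1.2.2
  rw [himage, hinj.encard_image, Set.encard_coe_eq_coe_finsetCard, hcard]

theorem exists_copy_cycleGraph_of_not_isAcyclic {G : SimpleGraph V} (h : ¬ G.IsAcyclic) :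
    ∃ n ≥ 3, Nonempty (Copy (cycleGraph n) G) := by
  rw [isAcyclic_iff_free_cycleGraph] at h
  push Not at h
  obtain ⟨n, hn, h⟩ := h
  exact ⟨n, hn, h⟩

theorem inducesTriangle_of_not_isAcyclic {G : SimpleGraph V} {A : Finset V} (hA : A.card ≤ 3)
    (h : ¬ (G.induce (A : Set V)).IsAcyclic) : G.InducesTriangle A := by
  obtain ⟨n, hn, ⟨f⟩⟩ := exists_copy_cycleGraph_of_not_isAcyclic h
  have hle := Fintype.card_le_of_injective f f.injective
  have hcard : Fintype.card (A : Set V) = A.card := by simp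
  rw [Fintype.card_fin, hcard] at hle
  obtain rfl : n = 3 := by omega
  have hbij : Function.Bijective f :=
    (Fintype.bijective_iff_injective_and_card f).2 ⟨f.injective, by
      rw [hcard, Fintype.card_fin]; omega⟩
  refine ⟨(RelIso.mk (Equiv.ofBijective f hbij) fun {a b} => ?_ :
    completeGraph (Fin 3) ≃g G.induce (A : Set V)).symm⟩
  constructor
  · intro hab
    exact fun heq => hab.ne (congrArg f heq)
  · intro hab
    refine f.toHom.map_adj ?_
    rw [cycleGraph_three_eq_top]
    exact hab

/-- A finite connected graph all of whose degrees are two is a cycle. -/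
theorem Connected.isCycleGraph_of_degree_eq_two [Fintype V] {G : SimpleGraph V}
    [DecidableRel G.Adj] (hconn : G.Connected) (hdeg : ∀ v, G.degree v = 2) : G.IsCycleGraph := by
  classical
  have hcyc : ¬ G.IsAcyclic := by
    intro hac
    have : Nontrivial V := by
      obtain ⟨v⟩ := hconn.nonempty
      obtain ⟨w, hw⟩ := (G.degree_pos_iff_exists_adj v).1 (by rw [hdeg]; omega)
      exact ⟨v, w, hw.ne⟩
    obtain ⟨v, hv⟩ := IsTree.exists_vert_degree_one_of_nontrivial ⟨hconn, hac⟩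
    rw [hdeg] at hv
    omega
  obtain ⟨n, hn, ⟨f⟩⟩ := exists_copy_cycleGraph_of_not_isAcyclic hcyc
  obtain ⟨m, rfl⟩ : ∃ m, n = m + 3 := ⟨n - 3, by omega⟩
  have hnbr : ∀ i v, G.Adj (f i) v → ∃ j, (cycleGraph (m + 3)).Adj i j ∧ f j = v := by
    intro i v hv
    have hsub : ((cycleGraph (m + 3)).neighborFinset i).image f ⊆ G.neighborFinset (f i) := by
      intro w hw
      obtain ⟨j, hj, rfl⟩ := Finset.mem_image.1 hw
      rw [mem_neighborFinset] at hj ⊢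
      exact f.toHom.map_adj hj
    have heq := Finset.eq_of_subset_of_card_le hsub (by
      rw [Finset.card_image_of_injective (f := f) _ f.injective, card_neighborFinset_eq_degree,
        card_neighborFinset_eq_degree, hdeg, cycleGraph_degree_three_le])
    have hv' : v ∈ G.neighborFinset (f i) := (mem_neighborFinset _ _ _).2 hv
    rw [← heq] at hv'
    obtain ⟨j, hj, hjv⟩ := Finset.mem_image.1 hv'
    exact ⟨j, (mem_neighborFinset _ _ _).1 hj, hjv⟩
  have hsurj : Function.Surjective f := by
    intro v
    by_contra hv
    obtain ⟨x, y, ⟨i, rfl⟩, hy, hxy⟩ :=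
      hconn.exists_adj_boundary (p := fun v => ∃ i, f i = v) ⟨0, rfl⟩ hv
    obtain ⟨j, -, hj⟩ := hnbr i y hxy
    exact hy ⟨j, hj⟩
  refine ⟨m + 3, hn, ⟨(RelIso.mk (Equiv.ofBijective f ⟨f.injective, hsurj⟩) fun {a b} => ?_ :
    cycleGraph (m + 3) ≃g G).symm⟩⟩
  constructor
  · intro hab
    obtain ⟨j, hj, hjb⟩ := hnbr a (f b) hab
    exact f.injective hjb ▸ hj
  · exact fun hab => f.toHom.map_adj hab

theorem IsVertexTransitive.degree_eq [Fintype V] {G : SimpleGraph V} [DecidableRel G.Adj]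
    (htrans : G.IsVertexTransitive) (u v : V) : G.degree u = G.degree v := by
  obtain ⟨φ, rfl⟩ := htrans u v
  exact (φ.degree_eq u).symm

/-- A connected graph of maximum degree at most one is complete on at most two
vertices. -/
theorem Connected.exists_iso_completeGraph_of_degree_le_one [Fintype V] {G : SimpleGraph V}
    [DecidableRel G.Adj] (hconn : G.Connected) (hdeg : ∀ v, G.degree v ≤ 1) :
    ∃ n : ℕ, n ≤ 2 ∧ Nonempty (G ≃g completeGraph (Fin n)) := by
  classical
  obtain ⟨v⟩ := hconn.nonempty
  have hnbr : ∀ x y z, G.Adj x y → G.Adj x z → y = z := by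
    intro x y z hy hz
    exact Finset.card_le_one.1 (hdeg x) y (by simpa using hy) z (by simpa using hz)
  have hadj : ∀ w, w = v ∨ G.Adj v w := by
    intro w
    by_contra hw
    obtain ⟨x, y, hx, hy, hxy⟩ :=
      hconn.exists_adj_boundary (p := fun w => w = v ∨ G.Adj v w) (Or.inl rfl) hw
    rcases hx with rfl | hx
    · exact hy (Or.inr hxy)
    · exact hy (Or.inl (hnbr x y v hxy hx.symm))
  have htop : G = ⊤ := by
    ext x y
    rw [top_adj]
    refine ⟨Adj.ne, fun hne => ?_⟩
    rcases hadj x with rfl | hx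
    · exact (hadj y).resolve_left hne.symm
    · rcases hadj y with rfl | hy
      · exact hx.symm
      · exact absurd (hnbr v x y hx hy) hne
  refine ⟨Fintype.card V, ?_, ?_⟩
  · have h1 : Finset.univ ⊆ insert v (G.neighborFinset v) := by
      intro w _
      simpa using hadj w
    have h2 := (Finset.card_le_card h1).trans (Finset.card_insert_le _ _)
    rw [Finset.card_univ, card_neighborFinset_eq_degree] at h2
    have := hdeg v
    omega
  · rw [htop]
    exact ⟨Iso.completeGraph (Fintype.equivFin V)⟩

end SimpleGraph

open SimpleGraph

theorem corollary2 {V : Type*} [Finite V] (G : SimpleGraph V) (hconn : G.Connected)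
    (htrans : G.IsVertexTransitive) :
    G.IsEssentiallyFourConnected ∨ G.IsCycleGraph ∨
      ∃ n : ℕ, n ≤ 4 ∧ Nonempty (G ≃g SimpleGraph.completeGraph (Fin n)) := by
  classical
  have := Fintype.ofFinite V
  obtain ⟨v₀⟩ := hconn.nonempty
  obtain ⟨d, hd⟩ : ∃ d, ∀ v, G.degree v = d := ⟨_, fun v => htrans.degree_eq v v₀⟩
  by_cases hd1 : d ≤ 1
  · obtain ⟨n, hn, hiso⟩ :=
      hconn.exists_iso_completeGraph_of_degree_le_one fun v => (hd v).trans_le hd1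
    exact Or.inr (Or.inr ⟨n, by omega, hiso⟩)
  by_cases hd2 : d = 2
  · exact Or.inr (Or.inl (hconn.isCycleGraph_of_degree_eq_two fun v => (hd v).trans hd2))
  by_cases hK4 : Nonempty (G ≃g completeGraph (Fin 4))
  · exact Or.inr (Or.inr ⟨4, le_rfl, hK4⟩)
  have hd3 : 3 ≤ d := by omega
  have hsep : ∀ c ≤ 3, c < d → ∀ P S Q : Finset V, G.IsVertexSep P S Q → c < S.card :=
    fun c hc hcd P S Q h =>
      h.lt_card_of_isVertexTransitive hconn htrans hc fun v => by rw [hd]; exact hcd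
  have hcard : 3 < Fintype.card V := by
    have := G.degree_lt_card_verts v₀
    rw [hd] at this
    omega
  refine Or.inl ⟨isThreeConnected_of_forall_isVertexSep hcard (hsep 2 (by omega) (by omega)),
    fun A B hAB hcyc => ?_, hK4⟩
  lift A to Finset V using A.toFinite
  lift B to Finset V using B.toFinite
  obtain ⟨⟨⟨hcover, hA, hB⟩, horder, -⟩, hstrong⟩ := hAB
  rw [separationOrder, encard_separatorEdges, ← Finset.coe_inter,
    Set.encard_coe_eq_coe_finsetCard] at horder
  rw [encard_separatorEdges]
  norm_cast at horder hA hB hstrong ⊢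
  have hcover' : ∀ v, v ∈ A ∨ v ∈ B := fun v => by
    have := hcover.symm ▸ Set.mem_univ v
    simpa using this
  by_cases hd4 : 3 < d
  · refine absurd (lt_card_add_edgeCount (hsep 3 le_rfl hd4) (fun v => by rw [hd]; exact hd4)
      (X := A \ B) (K := A ∩ B) (Y := B \ A) (fun v => ?_) ?_ ?_ ?_ hA hB) (by omega)
    · have := hcover' v
      simp only [Finset.mem_sdiff, Finset.mem_inter]
      tauto
    all_goals
      rw [Finset.disjoint_left]
      intro v
      simp only [Finset.mem_sdiff, Finset.mem_inter]
      tauto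
  · have hinter : A ∩ B = ∅ := by
      rw [Finset.eq_empty_iff_forall_notMem]
      intro v hv
      have h1 := hstrong v hv
      rw [Set.encard_eq_coe_toFinset_card, ← neighborFinset_def, card_neighborFinset_eq_degree,
        hd] at h1
      exact hd4 (by exact_mod_cast h1)
    have hBA : B = Aᶜ := by
      ext v
      have h1 := hcover' v
      have h2 : v ∉ A ∩ B := by simp [hinter]
      rw [Finset.mem_inter] at h2
      rw [Finset.mem_compl]
      tauto
    subst hBA
    have hs1 : A \ Aᶜ = A := by ext; simp
    have hs2 : Aᶜ \ A = Aᶜ := by ext; simp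
    rw [hinter, Finset.card_empty, zero_add, hs1, hs2] at horder
    rw [hs1, hs2]
    have hcut : ∀ X : Finset V, X.Nonempty → Xᶜ.Nonempty → 2 < G.edgeCount X Xᶜ := by
      intro X hX hX'
      have := lt_card_add_edgeCount (hsep 2 (by omega) (by omega))
        (fun v => by rw [hd]; omega) (X := X) (K := ∅) (Y := Xᶜ) (fun v => by simp [em])
        (by simp) (by simp) disjoint_compl_right hX hX'
      simpa using this
    refine ⟨horder, ?_⟩
    rcases le_total A.card Aᶜ.card with hle | hle
    · exact Or.inl (inducesTriangle_of_not_isAcyclic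
        (card_le_three_of_edgeCount_eq_three htrans hcut horder hle) hcyc.1)
    · refine Or.inr (inducesTriangle_of_not_isAcyclic
        (card_le_three_of_edgeCount_eq_three htrans hcut ?_ ?_) hcyc.2)
      · rwa [compl_compl, edgeCount_comm]
      · rwa [compl_compl]
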